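/- Let $G$ be a finite graph, with loops and multiple edges allowed, with vertex set $V$ and edge set $E$, and fix a reference orientation of its edges. Let $\mathcal F(G)\subset\mathbb Z^{E}$ be the lattice of integer flows of $G$, with the Euclidean inner product $(\cdot,\cdot)$ of $\mathbb R^{E}$, and let $V(G)$ be its Voronoi cell, i.e. the set of points of the real span $\mathcal F(G)\otimes\mathbb R\subset\mathbb R^{E}$ that are at least as close to the origin as to every other point of $\mathcal F(G)$. Let $\mathcal V(G)$ be the poset of nonempty faces of $V(G)$ (including $V(G)$ itself), ordered by inclusion. Let $\mathcal S(G)$ be the set of pairs $(H,\omega_H)$, where $H$ is a spanning subgraph of $G$ (given by a subset of $E$) and $\omega_H$ is an orientation of $H$ that is strongly connected on every connected component of $H$, ordered by $(H,\omega_H)\preceq(H',\omega'_{H'})$ iff $H'\subseteq H$ and $\omega'_{H'}$ is the restriction of $\omega_H$. An oriented circuit $C$ is given by a closed walk of positive length which returns neither to a vertex nor to an edge twice; it is regarded both as an element of $\mathcal F(G)$ (with coefficients $0,\pm1$) and as an element of $\mathcal S(G)$, and $F_C=\{x\in V(G) : (x,C)=(C,C)/2\}$ is the face of $V(G)$ that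 it defines. There is a unique isomorphism of posets $\Phi:\mathcal V(G)\to\mathcal S(G)$ (Amini's isomorphism) such that the codimension of every face $F$ in $V(G)$ is the genus (rank of the group of integer flows) of the subgraph in $\Phi(F)$, and such that $\Phi(F_C)$ is $C$ with its cyclic orientation for every oriented circuit $C$ (so that the $F_C$ have codimension one). Moreover, let $F$ be a face of $V(G)$ expressed as an intersection $$F=F_{C_1}\cap F_{C_2}\cap\dots\cap F_{C_s}$$ for oriented circuits $C_1,\dots,C_s$. Then the orientations of these circuits are compatible, i.e. any two of them agree on their common edges, and $\Phi(F)$ is the subgraph $C_1\cup C_2\cup\dots\cup C_s$ with the induced orientation, i.e. the orientation that restricts to the given one on each $C_i$. -/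

import Mathlib

/-- A multigraph with vertex set `V` and edge set `E`, together with a reference orientation:
`e` runs from `src e` to `tgt e`. Loops and multiple edges are allowed. -/
structure OrientedMultigraph (V E : Type*) where
  src : E → V
  tgt : E → V

namespace OrientedMultigraph

variable {V E : Type*}

/-- A (spanning) subgraph `H` of `G` together with an orientation of `H` is recorded by a sign
vector `σ : E → SignType`: the edges of `H` are those with `σ e ≠ 0`, and such an edge is oriented
along its reference direction if `σ e = 1` and against it if `σ e = -1`. (In particular a loop has
two orientations.) `G.Arc σ e u v` says that `e` is an edge of `H` oriented from `u` to `v`. -/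
def Arc (G : OrientedMultigraph V E) (σ : E → SignType) (e : E) (u v : V) : Prop :=
  (σ e = 1 ∧ G.src e = u ∧ G.tgt e = v) ∨ (σ e = -1 ∧ G.tgt e = u ∧ G.src e = v)

/-- The oriented subgraph `σ` is strongly connected on each connected component: any two vertices
joined by an undirected walk are joined by a directed one. -/
def IsStronglyConnected (G : OrientedMultigraph V E) (σ : E → SignType) : Prop :=
  ∀ u v : V, Relation.EqvGen (fun a b => ∃ e, G.Arc σ e a b) u v →
    Relation.ReflTransGen (fun a b => ∃ e, G.Arc σ e a b) u v

/-- The set of pairs `(H, ω)`, where `H` is a subgraph of `G` and `ω` is a strongly connected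
orientation of `H`. -/
@[ext] structure StrongOrientation (G : OrientedMultigraph V E) where
  dir : E → SignType
  strong : G.IsStronglyConnected dir

/-- `(H, ω) ≤ (H', ω')` if `H'` is a subgraph of `H` and `ω'` is the restriction of `ω` to `H'`. -/
instance (G : OrientedMultigraph V E) : PartialOrder (StrongOrientation G) where
  le σ τ := ∀ e, τ.dir e ≠ 0 → σ.dir e = τ.dir e
  le_refl _ _ _ := rfl
  le_trans σ τ ρ h₁ h₂ e he :=
    (h₁ e (by rw [h₂ e he]; exact he)).trans (h₂ e he)
  le_antisymm σ τ h₁ h₂ := by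
    ext1
    funext e
    by_cases h : τ.dir e = 0
    · by_cases h' : σ.dir e = 0
      · rw [h, h']
      · exact (h₂ e h').symm
    · exact h₁ e h

/-- The oriented subgraph `σ` is a circuit with a cyclic orientation: its edges are those of a
closed walk of length `n + 1 ≥ 1` that does not return to the same vertex or to the same edge,
oriented along the walk. (Addition in `Fin (n + 1)` is cyclic.) -/
def IsOrientedCircuit (G : OrientedMultigraph V E) (σ : E → SignType) : Prop :=
  ∃ (n : ℕ) (vertex : Fin (n + 1) → V) (edge : Fin (n + 1) → E),
    Function.Injective vertex ∧ Function.Injective edge ∧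
    (∀ e, σ e ≠ 0 ↔ e ∈ Set.range edge) ∧
    ∀ i, G.Arc σ (edge i) (vertex i) (vertex (i + 1))

/-- Oriented circuits of `G`. -/
structure OrientedCircuit (G : OrientedMultigraph V E) where
  dir : E → SignType
  isCircuit : G.IsOrientedCircuit dir

/-- Two oriented circuits are compatible if they agree on their common edges. -/
def OrientedCircuit.Compatible {G : OrientedMultigraph V E} (C D : OrientedCircuit G) : Prop :=
  ∀ e, C.dir e ≠ 0 → D.dir e ≠ 0 → C.dir e = D.dir e

/-- The edges of an oriented circuit. -/
def OrientedCircuit.edges {G : OrientedMultigraph V E} (C : OrientedCircuit G) : Set E :=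
  {e | C.dir e ≠ 0}

/-- The edges of the subgraph `H` of a pair `(H, ω)`. -/
def StrongOrientation.edges {G : OrientedMultigraph V E} (σ : StrongOrientation G) : Set E :=
  {e | σ.dir e ≠ 0}

section Flows

variable [DecidableEq V] [Fintype E]

/-- The lattice of integer flows, a subgroup of `ℤ^E`. -/
def intFlows (G : OrientedMultigraph V E) : Submodule ℤ (E → ℤ) where
  carrier := {a | ∀ v, (∑ e, if G.tgt e = v then a e else 0) -
    (∑ e, if G.src e = v then a e else 0) = 0}
  zero_mem' := by simp
  add_mem' := by
    intro a b ha hb v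
    have key : ∀ f : E → V, (∑ e, if f e = v then (a + b) e else 0) =
        (∑ e, if f e = v then a e else 0) + ∑ e, if f e = v then b e else 0 := by
      intro f
      rw [← Finset.sum_add_distrib]
      refine Finset.sum_congr rfl fun e _ => ?_
      split_ifs <;> simp
    have h₁ := ha v
    have h₂ := hb v
    rw [key, key]
    linarith
  smul_mem' := by
    intro c a ha v
    have key : ∀ f : E → V, (∑ e, if f e = v then (c • a) e else 0) =
        c * ∑ e, if f e = v then a e else 0 := by
      intro f
      rw [Finset.mul_sum]
      refine Finset.sum_congr rfl fun e _ => ?_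
      split_ifs <;> simp
    rw [key, key, ← mul_sub, ha v, mul_zero]

/-- The integer flows of the subgraph `H` of a pair `(H, ω)`. -/
def StrongOrientation.flows {G : OrientedMultigraph V E} (σ : StrongOrientation G) :
    Submodule ℤ (E → ℤ) where
  carrier := {a | a ∈ G.intFlows ∧ ∀ e, e ∉ σ.edges → a e = 0}
  zero_mem' := ⟨zero_mem _, fun _ _ => rfl⟩
  add_mem' := fun ha hb => ⟨add_mem ha.1 hb.1, fun e he => by simp [ha.2 e he, hb.2 e he]⟩
  smul_mem' := fun c _ ha => ⟨Submodule.smul_mem _ c ha.1, fun e he => by simp [ha.2 e he]⟩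

/-- The genus of the subgraph `H` of a pair `(H, ω)`: the rank of its group of integer flows. -/
noncomputable def StrongOrientation.genus {G : OrientedMultigraph V E}
    (σ : StrongOrientation G) : ℕ :=
  Module.finrank ℤ σ.flows

/-- An integer vector, seen in Euclidean space. -/
noncomputable def toEuclidean (a : E → ℤ) : EuclideanSpace ℝ E :=
  WithLp.toLp 2 fun e => (a e : ℝ)

/-- The real vector space generated by the lattice of integer flows. -/
noncomputable def flowSpace (G : OrientedMultigraph V E) : Submodule ℝ (EuclideanSpace ℝ E) :=
  Submodule.span ℝ (toEuclidean '' (G.intFlows : Set (E → ℤ)))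

/-- The Voronoi cell of the lattice of integer flows. -/
def voronoiCell (G : OrientedMultigraph V E) : Set (EuclideanSpace ℝ E) :=
  {x | x ∈ G.flowSpace ∧ ∀ a ∈ G.intFlows, dist x 0 ≤ dist x (toEuclidean a)}

/-- The nonempty faces of the Voronoi cell (the cell itself included), ordered by inclusion. -/
abbrev VoronoiFace (G : OrientedMultigraph V E) :=
  {F : Set (EuclideanSpace ℝ E) // F.Nonempty ∧ IsExposed ℝ G.voronoiCell F}

/-- The codimension of a face in the Voronoi cell. -/
noncomputable def faceCodim {G : OrientedMultigraph V E} (F : VoronoiFace G) : ℕ :=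
  Module.finrank ℝ G.flowSpace - Module.finrank ℝ (vectorSpan ℝ F.1)

/-- The element of `ℤ^E` given by an oriented circuit. -/
def OrientedCircuit.vec {G : OrientedMultigraph V E} (C : OrientedCircuit G) : E → ℤ :=
  fun e => (C.dir e : ℤ)

theorem OrientedCircuit.vec_mem {G : OrientedMultigraph V E} (C : OrientedCircuit G) :
    C.vec ∈ G.intFlows := by
  classical
  obtain ⟨n, vertex, edge, -, hedge, hsupp, harc⟩ := C.isCircuit
  intro v
  rw [← Finset.sum_sub_distrib]
  have h0 : ∀ e ∉ Finset.univ.image edge,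
      ((if G.tgt e = v then C.vec e else 0) - if G.src e = v then C.vec e else 0) = 0 := by
    intro e he
    have : C.dir e = 0 := by
      by_contra h
      obtain ⟨i, hi⟩ := (hsupp e).1 h
      exact he (Finset.mem_image.2 ⟨i, Finset.mem_univ _, hi⟩)
    simp [OrientedCircuit.vec, this]
  rw [← Finset.sum_subset (Finset.subset_univ (Finset.univ.image edge)) fun e _ he => h0 e he,
    Finset.sum_image fun _ _ _ _ h => hedge h]
  have h1 : ∀ i, ((if G.tgt (edge i) = v then C.vec (edge i) else 0) -
      if G.src (edge i) = v then C.vec (edge i) else 0) =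
      (if vertex (i + 1) = v then (1 : ℤ) else 0) - if vertex i = v then 1 else 0 := by
    intro i
    rcases harc i with ⟨h, hs, ht⟩ | ⟨h, hs, ht⟩
    · simp [OrientedCircuit.vec, h, hs, ht]
    · simp only [OrientedCircuit.vec, h, hs, ht]
      split_ifs <;> simp
  rw [Finset.sum_congr rfl fun i _ => h1 i, Finset.sum_sub_distrib, sub_eq_zero]
  exact Equiv.sum_comp (Equiv.addRight (1 : Fin (n + 1))) (fun i => if vertex i = v then (1 : ℤ) else 0)

/-- The intersection of the Voronoi cell with the perpendicular bisector of the circuit `C`. -/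
def OrientedCircuit.facetSet {G : OrientedMultigraph V E} (C : OrientedCircuit G) :
    Set (EuclideanSpace ℝ E) :=
  {x | x ∈ G.voronoiCell ∧
    inner ℝ x (toEuclidean C.vec) = inner ℝ (toEuclidean C.vec) (toEuclidean C.vec) / 2}

theorem dist_zero_le_iff (x y : EuclideanSpace ℝ E) :
    dist x 0 ≤ dist x y ↔ inner ℝ x y ≤ inner ℝ y y / 2 := by
  rw [dist_zero_right, dist_eq_norm, ← sq_le_sq₀ (norm_nonneg _) (norm_nonneg _),
    norm_sub_sq_real, real_inner_self_eq_norm_sq]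
  constructor <;> intro h <;> linarith

theorem OrientedCircuit.half_mem {G : OrientedMultigraph V E} (C : OrientedCircuit G) :
    (2⁻¹ : ℝ) • toEuclidean C.vec ∈ G.voronoiCell := by
  refine ⟨Submodule.smul_mem _ _ (Submodule.subset_span ⟨_, C.vec_mem, rfl⟩), fun a _ => ?_⟩
  rw [dist_zero_le_iff, real_inner_smul_left]
  have : inner ℝ (toEuclidean C.vec) (toEuclidean a) ≤ inner ℝ (toEuclidean a) (toEuclidean a) := by
    simp only [PiLp.inner_apply, toEuclidean, RCLike.inner_apply, conj_trivial]
    refine Finset.sum_le_sum fun e _ => ?_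
    have h : a e * C.vec e ≤ a e * a e := by
      have hv : C.vec e = 0 ∨ C.vec e = -1 ∨ C.vec e = 1 := by
        unfold OrientedCircuit.vec
        cases C.dir e <;> simp
      rcases hv with hv | hv | hv <;> rw [hv]
      · nlinarith [mul_self_nonneg (a e)]
      · rcases le_or_gt 0 (a e) with h | h <;> nlinarith
      · rcases le_or_gt (a e) 0 with h | h <;> nlinarith
    exact_mod_cast h
  linarith

/-- The face `F_C` of the Voronoi cell defined by an oriented circuit `C`. -/
def OrientedCircuit.facet {G : OrientedMultigraph V E} (C : OrientedCircuit G) : VoronoiFace G :=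
  ⟨C.facetSet, by
    have hmem : (2⁻¹ : ℝ) • toEuclidean C.vec ∈ C.facetSet :=
      ⟨C.half_mem, by rw [real_inner_smul_left]; ring⟩
    refine ⟨⟨_, hmem⟩, fun _ => ⟨innerSL ℝ (toEuclidean C.vec), ?_⟩⟩
    have hle : ∀ y ∈ G.voronoiCell, inner ℝ y (toEuclidean C.vec) ≤
        inner ℝ (toEuclidean C.vec) (toEuclidean C.vec) / 2 :=
      fun y hy => (dist_zero_le_iff _ _).1 (hy.2 _ C.vec_mem)
    ext x
    simp only [innerSL_apply_apply, Set.mem_ofPred_eq]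
    constructor
    · rintro ⟨hx, h⟩
      refine ⟨hx, fun y hy => ?_⟩
      rw [real_inner_comm, real_inner_comm x, h]
      exact hle y hy
    · rintro ⟨hx, h⟩
      refine ⟨hx, le_antisymm (hle x hx) ?_⟩
      have := h _ C.half_mem
      rw [real_inner_smul_right, real_inner_comm x] at this
      linarith⟩

/-- `Φ` is Amini's isomorphism: an isomorphism from the poset of faces of the Voronoi cell to the
poset of strongly connected orientations of subgraphs, such that the codimension of a face is the
genus of the corresponding subgraph, and the face `F_C` of an oriented circuit `C` corresponds
to `C` with its cyclic orientation. -/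
def IsAminiIso {G : OrientedMultigraph V E} (Φ : VoronoiFace G ≃o StrongOrientation G) : Prop :=
  (∀ F, faceCodim F = (Φ F).genus) ∧ ∀ C : OrientedCircuit G, (Φ C.facet).dir = C.dir

end Flows

end OrientedMultigraph

namespace OrientedMultigraph

variable {V E : Type*} {G : OrientedMultigraph V E}

/-! Strongly connected orientations of subgraphs are exactly the sign vectors of real flows: a
covering by directed circuits gives a flow (`StrongOrientation.exists_flow`), and a cut argument
gives the converse (`isStronglyConnected_sign`).

Every real flow is a positive combination of circuits without cancellation (`realFlows_induction`).
Since `(C, C)` is the `ℓ¹`-norm of a circuit `C`, the Voronoi cell is the zonotope whose support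
function on flows is half the `ℓ¹`-norm (`mem_voronoiCell_iff`). Its exposed faces are the sets
`tightSet a` for real flows `a`; inclusion of faces is the order on sign vectors
(`tightSet_subset_iff`), and the flows supported in the support of `a` form the orthogonal
complement of the face direction, which gives the codimension.

A strongly connected orientation is determined by its directed circuits, and `C` lies in `Φ F` iff
`F ≤ F_C` (`IsAminiIso.le_facet_iff`). This yields both uniqueness and the description of
intersections of the `F_C`. -/

theorem Arc.ne_zero {σ : E → SignType} {e : E} {u v : V} (h : G.Arc σ e u v) : σ e ≠ 0 := by
  rcases h with ⟨h, -⟩ | ⟨h, -⟩ <;> simp [h]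

theorem Arc.congr {σ τ : E → SignType} {e : E} {u v : V} (h : G.Arc σ e u v) (he : τ e = σ e) :
    G.Arc τ e u v := by
  simpa only [Arc, he] using h

theorem Arc.tail_unique {σ : E → SignType} {e : E} {u v u' v' : V} (h : G.Arc σ e u v)
    (h' : G.Arc σ e u' v') : u = u' := by
  rcases h with ⟨h, rfl, -⟩ | ⟨h, rfl, -⟩ <;> rcases h' with ⟨h', rfl, -⟩ | ⟨h', rfl, -⟩ <;>
    first | rfl | (rw [h] at h'; exact absurd h' (by decide))

theorem exists_arc {σ : E → SignType} {e : E} (he : σ e ≠ 0) : ∃ u v, G.Arc σ e u v := by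
  rcases h : σ e with _ | _ | _
  · exact absurd h he
  · exact ⟨_, _, Or.inr ⟨h, rfl, rfl⟩⟩
  · exact ⟨_, _, Or.inl ⟨h, rfl, rfl⟩⟩

/-! ### Directed walks and circuits -/

/-- Vertices joined by a chain are joined by a chain without repetitions. -/
theorem exists_injOn_chain {r : V → V → Prop} {a b : V} (h : Relation.ReflTransGen r a b) :
    ∃ (n : ℕ) (p : ℕ → V), p 0 = a ∧ p n = b ∧ (∀ i < n, r (p i) (p (i + 1))) ∧
      ∀ i j, i < j → j ≤ n → p i ≠ p j := by
  classical
  have hex : ∃ n, ∃ p : ℕ → V, p 0 = a ∧ p n = b ∧ ∀ i < n, r (p i) (p (i + 1)) := by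
    induction h with
    | refl => exact ⟨0, fun _ => a, rfl, rfl, by simp⟩
    | @tail b c _ hbc ih =>
      obtain ⟨n, p, h0, hn, hp⟩ := ih
      refine ⟨n + 1, fun i => if i ≤ n then p i else c, by simp [h0], by simp, fun i hi => ?_⟩
      rcases Nat.lt_succ_iff_lt_or_eq.1 hi with h | rfl
      · simpa [h.le, Nat.succ_le_iff.2 h] using hp i h
      · simpa [hn] using hbc
  obtain ⟨p, h0, hn, hp⟩ := Nat.find_spec hex
  refine ⟨Nat.find hex, p, h0, hn, hp, fun i j hij hj heq => ?_⟩
  -- In a shortest chain, `p i = p j` would allow the stretch from `i` to `j` to be cut out.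
  refine Nat.find_min hex (m := Nat.find hex - (j - i)) (by omega)
    ⟨fun k => if k ≤ i then p k else p (k + (j - i)), by simp [h0], ?_, fun k hk => ?_⟩
  · by_cases h : Nat.find hex - (j - i) ≤ i
    · have : j = Nat.find hex := by omega
      have h' : Nat.find hex - (j - i) = i := by omega
      simp only [h', le_refl, if_true]
      rw [heq, ← hn, ← this]
    · simp only [h, if_false]
      rw [Nat.sub_add_cancel (by omega), hn]
  · rcases lt_trichotomy k i with h | rfl | h
    · simpa [h.le, Nat.succ_le_iff.2 h] using hp k (by omega)
    · have := hp j (by omega)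
      rw [← heq] at this
      have e1 : k + 1 + (j - k) = j + 1 := by omega
      simpa [e1] using this
    · have := hp (k + (j - i)) (by omega)
      have e1 : k + 1 + (j - i) = k + (j - i) + 1 := by omega
      simpa [not_le.2 h, not_le.2 (h.trans (Nat.lt_succ_self k)), e1] using this

/-- Every arc of a strongly connected orientation lies on a directed circuit. -/
theorem exists_circuit {σ : E → SignType} (hσ : G.IsStronglyConnected σ) {e : E} (he : σ e ≠ 0) :
    ∃ C : OrientedCircuit G, C.dir e ≠ 0 ∧ ∀ e', C.dir e' ≠ 0 → σ e' = C.dir e' := by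
  classical
  obtain ⟨u, v, huv⟩ := exists_arc (G := G) he
  obtain ⟨n, p, h0, hn, hp, hinj⟩ := exists_injOn_chain
    (hσ v u (.symm _ _ (.rel _ _ ⟨e, huv⟩)))
  choose f hf using hp
  let vertex : Fin (n + 1) → V := fun i => p i
  -- The path from the head of `e` back to its tail is closed up by `e` as last edge; `n = 0` is the
  -- case of a loop.
  let edge : Fin (n + 1) → E := fun i => if h : i.1 < n then f i h else e
  have hv : Function.Injective vertex := by
    intro i j hij
    rcases lt_trichotomy i j with h | h | h
    · exact absurd hij (hinj _ _ h (by omega))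
    · exact h
    · exact absurd hij.symm (hinj _ _ h (by omega))
  have harc : ∀ i, G.Arc σ (edge i) (vertex i) (vertex (i + 1)) := by
    intro i
    by_cases h : i.1 < n
    · have : ((i + 1 : Fin (n + 1)) : ℕ) = i + 1 := Fin.val_add_one_of_lt' (by omega)
      simpa only [edge, vertex, h, dif_pos, this] using hf i h
    · have : i = Fin.last n := by ext; simp; omega
      subst this
      simpa [edge, vertex, h0, hn] using huv
  let τ : E → SignType := fun e' => if e' ∈ Set.range edge then σ e' else 0
  have hτ : ∀ i, τ (edge i) = σ (edge i) := fun i => by simp [τ]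
  refine ⟨⟨τ, n, vertex, edge, hv, fun i j hij => ?_, fun e' => ?_, fun i => ?_⟩, ?_, ?_⟩
  · have h := harc j
    rw [← hij] at h
    exact hv ((harc i).tail_unique h)
  · constructor
    · intro h
      by_contra h'
      exact h (by simp only [τ, h', if_false])
    · rintro ⟨i, rfl⟩
      rw [hτ]
      exact (harc i).ne_zero
  · exact (harc i).congr (hτ i)
  · have : edge (Fin.last n) = e := by simp [edge]
    change τ e ≠ 0
    rw [← this, hτ, this]
    exact he
  · intro e' he'
    by_cases h : e' ∈ Set.range edge
    · change _ = τ e'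
      simp only [τ, h, if_true]
    · exact absurd (if_neg h) he'

/-- An orientation whose arcs can all be reversed by directed walks is strongly connected. -/
theorem isStronglyConnected_of_arc {σ : E → SignType}
    (h : ∀ e u v, G.Arc σ e u v → Relation.ReflTransGen (fun a b => ∃ e, G.Arc σ e a b) v u) :
    G.IsStronglyConnected σ := by
  have hs : ∀ u v, Relation.ReflTransGen (fun a b => ∃ e, G.Arc σ e a b) u v →
      Relation.ReflTransGen (fun a b => ∃ e, G.Arc σ e a b) v u := by
    intro u v huv
    induction huv with
    | refl => exact .refl
    | tail _ hbc ih =>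
      obtain ⟨e, he⟩ := hbc
      exact (h e _ _ he).trans ih
  intro u v huv
  induction huv with
  | rel _ _ h => exact .single h
  | refl => exact .refl
  | symm _ _ _ ih => exact hs _ _ ih
  | trans _ _ _ _ _ ih₁ ih₂ => exact ih₁.trans ih₂

theorem sign_signType_cast (s : SignType) : SignType.sign (s : ℝ) = s := by
  cases s <;> simp

theorem abs_signType_cast {s : SignType} (hs : s ≠ 0) : |(s : ℝ)| = 1 := by
  rcases s.trichotomy with rfl | rfl | rfl <;> simp at hs ⊢

@[simp] theorem toEuclidean_apply (a : E → ℤ) (e : E) : toEuclidean a e = a e := rfl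

theorem OrientedCircuit.toEuclidean_vec_apply (C : OrientedCircuit G) (e : E) :
    toEuclidean C.vec e = (C.dir e : ℝ) := by
  simp [OrientedCircuit.vec]

/-! ### Real flows, their signs and their circuit decompositions -/

section Flows

variable [DecidableEq V] [Fintype E]

/-- The real flows of `G`. -/
def realFlows (G : OrientedMultigraph V E) : Submodule ℝ (EuclideanSpace ℝ E) where
  carrier := {a | ∀ v, ∑ e, ((if G.tgt e = v then 1 else 0) - if G.src e = v then 1 else 0) * a e = 0}
  zero_mem' := by simp
  add_mem' := by
    intro a b ha hb v
    simp only [PiLp.add_apply, mul_add, Finset.sum_add_distrib, ha v, hb v, add_zero]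
  smul_mem' := by
    intro c a ha v
    simp only [PiLp.smul_apply, smul_eq_mul, mul_left_comm _ c, ← Finset.mul_sum, ha v, mul_zero]

theorem toEuclidean_mem_realFlows {a : E → ℤ} (ha : a ∈ G.intFlows) :
    toEuclidean a ∈ G.realFlows := by
  intro v
  have h := ha v
  rw [← Finset.sum_sub_distrib] at h
  have h' : ((∑ e, ((if G.tgt e = v then a e else 0) - if G.src e = v then a e else 0) : ℤ) : ℝ)
      = 0 := by rw [h, Int.cast_zero]
  rw [← h', Int.cast_sum]
  refine Finset.sum_congr rfl fun e _ => ?_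
  rw [toEuclidean_apply]
  split_ifs <;> simp

/-- Flows are orthogonal to coboundaries: weight conservation at `v` by `f v` and exchange the sums.
-/
theorem sum_potential_mul_eq_zero [Fintype V] {a : EuclideanSpace ℝ E} (ha : a ∈ G.realFlows)
    (f : V → ℝ) : ∑ e, (f (G.tgt e) - f (G.src e)) * a e = 0 := by
  have h : ∑ v, f v * ∑ e, ((if G.tgt e = v then 1 else 0) -
      if G.src e = v then 1 else 0) * a e = 0 :=
    Finset.sum_eq_zero fun v _ => by rw [ha v, mul_zero]
  simp only [Finset.mul_sum] at h
  rw [Finset.sum_comm] at h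
  rw [← h]
  refine Finset.sum_congr rfl fun e _ => ?_
  simp only [← mul_assoc, ← Finset.sum_mul, mul_sub, Finset.sum_sub_distrib, mul_ite, mul_one,
    mul_zero, Finset.sum_ite_eq, Finset.mem_univ, if_true]

/-- The signs of a real flow form a strongly connected orientation of its support. -/
theorem isStronglyConnected_sign [Fintype V] {a : EuclideanSpace ℝ E} (ha : a ∈ G.realFlows) :
    G.IsStronglyConnected fun e => SignType.sign (a e) := by
  classical
  refine isStronglyConnected_of_arc fun e u v he => ?_
  by_contra hu
  let r : V → V → Prop := fun x y => ∃ e, G.Arc (fun e => SignType.sign (a e)) e x y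
  -- No arc leaves the set of vertices reachable from `v`, so all terms of the pairing of `a` with
  -- the coboundary of `f` are nonnegative. They sum to zero, hence no arc enters the set either;
  -- but `e` would.
  let f : V → ℝ := fun x => if Relation.ReflTransGen r v x then 1 else 0
  have hmono : ∀ x y, r x y → f x ≤ f y := by
    intro x y hxy
    by_cases hx : Relation.ReflTransGen r v x
    · simp only [f, hx, hx.tail hxy, if_true, le_refl]
    · simp only [f, hx, if_false]
      split_ifs <;> norm_num
  have hnonneg : ∀ e ∈ Finset.univ, 0 ≤ (f (G.tgt e) - f (G.src e)) * a e := by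
    intro e _
    rcases lt_trichotomy (a e) 0 with h | h | h
    · exact mul_nonneg_of_nonpos_of_nonpos
        (sub_nonpos.2 (hmono _ _ ⟨e, Or.inr ⟨sign_neg h, rfl, rfl⟩⟩)) h.le
    · rw [h, mul_zero]
    · exact mul_nonneg (sub_nonneg.2 (hmono _ _ ⟨e, Or.inl ⟨sign_pos h, rfl, rfl⟩⟩)) h.le
  have hz := (Finset.sum_eq_zero_iff_of_nonneg hnonneg).1 (sum_potential_mul_eq_zero ha f) e
    (Finset.mem_univ e)
  have hne : a e ≠ 0 := sign_ne_zero.1 he.ne_zero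
  have hf : f (G.tgt e) = f (G.src e) := by
    rcases mul_eq_zero.1 hz with h | h
    · exact sub_eq_zero.1 h
    · exact absurd h hne
  have hv : f v = 1 := if_pos .refl
  have hu' : f u = 0 := if_neg hu
  rcases he with ⟨-, hs, ht⟩ | ⟨-, ht, hs⟩ <;> rw [hs, ht, hu', hv] at hf <;> norm_num at hf

/-- An oriented subgraph covered by directed circuits is the sign vector of a flow. -/
theorem exists_flow_of_cover {ι : Type*} [Fintype ι] (C : ι → OrientedCircuit G)
    {σ : E → SignType} (h₁ : ∀ i e, (C i).dir e ≠ 0 → σ e = (C i).dir e)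
    (h₂ : ∀ e, σ e ≠ 0 → ∃ i, (C i).dir e ≠ 0) :
    ∃ a ∈ G.realFlows, ∀ e, SignType.sign (a e) = σ e := by
  -- The circuits agree in sign with `σ`, so nothing cancels in their sum.
  refine ⟨∑ i, toEuclidean (C i).vec,
    Submodule.sum_mem _ fun i _ => toEuclidean_mem_realFlows (C i).vec_mem, fun e => ?_⟩
  have hsum : (∑ i, toEuclidean (C i).vec) e = (σ e : ℝ) * ∑ i, |((C i).dir e : ℝ)| := by
    rw [WithLp.ofLp_sum, Finset.sum_apply, Finset.mul_sum]
    refine Finset.sum_congr rfl fun i _ => ?_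
    rw [OrientedCircuit.toEuclidean_vec_apply]
    by_cases h : (C i).dir e = 0
    · simp [h]
    · rw [h₁ i e h, abs_signType_cast h, mul_one]
  rw [hsum]
  by_cases h : σ e = 0
  · simp [h]
  · obtain ⟨i, hi⟩ := h₂ e h
    have hpos : 0 < ∑ i, |((C i).dir e : ℝ)| :=
      Finset.sum_pos' (fun _ _ => abs_nonneg _)
        ⟨i, Finset.mem_univ _, by rw [abs_signType_cast hi]; exact one_pos⟩
    rw [sign_mul, sign_pos hpos, mul_one, sign_signType_cast]

theorem StrongOrientation.exists_flow (σ : StrongOrientation G) :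
    ∃ a ∈ G.realFlows, ∀ e, SignType.sign (a e) = σ.dir e := by
  classical
  choose C hC hC' using fun e : {e // σ.dir e ≠ 0} => exists_circuit σ.strong e.2
  exact exists_flow_of_cover C hC' fun e he => ⟨⟨e, he⟩, hC ⟨e, he⟩⟩

/-- Conformal decomposition of real flows into directed circuits. -/
theorem realFlows_induction [Fintype V] {P : EuclideanSpace ℝ E → Prop} (zero : P 0)
    (step : ∀ (a b : EuclideanSpace ℝ E) (C : OrientedCircuit G) (c : ℝ), 0 < c →
      a ∈ G.realFlows → b = a + c • toEuclidean C.vec →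
      (∀ e, |b e| = |a e| + c * |toEuclidean C.vec e|) → P a → P b)
    {b : EuclideanSpace ℝ E} (hb : b ∈ G.realFlows) : P b := by
  classical
  induction hn : (Finset.univ.filter fun e => b e ≠ 0).card using Nat.strong_induction_on
    generalizing b with
  | _ n ih =>
    by_cases h0 : b = 0
    · rw [h0]; exact zero
    obtain ⟨e₀, he₀⟩ : ∃ e, b e ≠ 0 := by
      by_contra! h
      exact h0 (by ext e; simp [h e])
    obtain ⟨C, hC, hC'⟩ := exists_circuit (isStronglyConnected_sign hb) (sign_ne_zero.2 he₀)
    -- Subtracting `|b e₁|` times `C` for a minimal `|b e₁|` reverses no sign and kills the edge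
    -- `e₁`, so the support shrinks strictly.
    obtain ⟨e₁, he₁, hmin⟩ := Finset.exists_min_image (Finset.univ.filter fun e => C.dir e ≠ 0)
      (fun e => |b e|) ⟨e₀, by simpa using hC⟩
    have he₁' : C.dir e₁ ≠ 0 := by simpa using he₁
    have hbC : ∀ e, C.dir e ≠ 0 → b e = |b e| * (C.dir e : ℝ) := fun e he => by
      rw [← hC' e he, abs_mul_sign]
    have hb₁ : b e₁ ≠ 0 := by
      rw [← sign_ne_zero, hC' e₁ he₁']
      exact he₁'
    set c := |b e₁| with hc
    have hcpos : 0 < c := abs_pos.2 hb₁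
    set a := b - c • toEuclidean C.vec with ha
    have hae : ∀ e, a e = b e - c * (C.dir e : ℝ) := fun e => by
      rw [ha, PiLp.sub_apply, PiLp.smul_apply, OrientedCircuit.toEuclidean_vec_apply, smul_eq_mul]
    have haflow : a ∈ G.realFlows := Submodule.sub_mem _ hb
      (Submodule.smul_mem _ _ (toEuclidean_mem_realFlows C.vec_mem))
    refine step a b C c hcpos haflow (by rw [ha, sub_add_cancel]) (fun e => ?_)
      (ih _ ?_ haflow rfl)
    · rw [hae, OrientedCircuit.toEuclidean_vec_apply]
      by_cases he : C.dir e = 0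
      · simp [he]
      · have h1 : b e - c * (C.dir e : ℝ) = (|b e| - c) * (C.dir e : ℝ) := by
          rw [sub_mul, ← hbC e he]
        rw [h1, abs_mul, abs_signType_cast he, mul_one, mul_one,
          abs_of_nonneg (sub_nonneg.2 (hmin e (by simpa using he))), sub_add_cancel]
    · rw [← hn]
      refine Finset.card_lt_card (Finset.ssubset_iff_of_subset ?_ |>.2 ⟨e₁, by simpa using hb₁, ?_⟩)
      · intro e
        simp only [Finset.mem_filter, Finset.mem_univ, true_and, hae]
        intro h hbe
        refine h ?_
        have : C.dir e = 0 := by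
          by_contra he
          refine he ?_
          rw [← hC' e he, hbe, sign_zero]
        simp [hbe, this]
      · simp only [Finset.mem_filter, Finset.mem_univ, true_and, not_not, hae]
        rw [hc, ← hbC e₁ he₁', sub_self]

/-- A real flow is a combination of integer flows vanishing where it vanishes. -/
theorem mem_span_of_mem_realFlows [Fintype V] {T : Set E} {b : EuclideanSpace ℝ E}
    (hb : b ∈ G.realFlows) (hT : ∀ e ∉ T, b e = 0) :
    b ∈ Submodule.span ℝ (toEuclidean '' {a | a ∈ G.intFlows ∧ ∀ e ∉ T, a e = 0}) := by
  revert hT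
  refine realFlows_induction (P := fun b => (∀ e ∉ T, b e = 0) → b ∈ Submodule.span ℝ
    (toEuclidean '' {a | a ∈ G.intFlows ∧ ∀ e ∉ T, a e = 0})) (fun _ => Submodule.zero_mem _)
    (fun a b C c hc _ hab habs ih hT => ?_) hb
  -- Absolute values add up, so both summands vanish wherever the sum does.
  have h : ∀ e ∉ T, a e = 0 ∧ toEuclidean C.vec e = 0 := by
    intro e he
    have h := habs e
    rw [hT e he, abs_zero] at h
    have h1 := abs_nonneg (a e)
    have h2 := mul_nonneg hc.le (abs_nonneg (toEuclidean C.vec e))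
    refine ⟨abs_eq_zero.1 (by linarith), ?_⟩
    have h3 : c * |toEuclidean C.vec e| = 0 := by linarith
    exact abs_eq_zero.1 ((mul_eq_zero.1 h3).resolve_left hc.ne')
  rw [hab]
  refine Submodule.add_mem _ (ih fun e he => (h e he).1) (Submodule.smul_mem _ _
    (Submodule.subset_span ⟨C.vec, ⟨C.vec_mem, fun e he => ?_⟩, rfl⟩))
  exact Int.cast_eq_zero.1 (h e he).2

theorem flowSpace_eq_realFlows [Fintype V] (G : OrientedMultigraph V E) :
    G.flowSpace = G.realFlows := by
  apply le_antisymm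
  · rw [flowSpace, Submodule.span_le]
    rintro _ ⟨a, ha, rfl⟩
    exact toEuclidean_mem_realFlows ha
  · intro b hb
    refine Submodule.span_mono (Set.image_mono fun a ha => ha.1)
      (mem_span_of_mem_realFlows (T := Set.univ) hb fun e he => absurd (Set.mem_univ e) he)

/-- The integer flows of the subgraph lie in `ℤ^E`, hence are discrete, and they span `W`; so their
rank is its real dimension. -/
theorem StrongOrientation.genus_eq [Fintype V] (σ : StrongOrientation G)
    {W : Submodule ℝ (EuclideanSpace ℝ E)}
    (hW : ∀ b, b ∈ W ↔ b ∈ G.realFlows ∧ ∀ e, σ.dir e = 0 → b e = 0) :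
    σ.genus = Module.finrank ℝ W := by
  let f : (E → ℤ) →ₗ[ℤ] EuclideanSpace ℝ E :=
    { toFun := toEuclidean
      map_add' := fun a b => by ext e; simp
      map_smul' := fun c a => by ext e; simp }
  have hf : Function.Injective f := fun a b h => by
    funext e
    have : toEuclidean a e = toEuclidean b e := congrArg (fun x : EuclideanSpace ℝ E => x e) h
    simpa using this
  have hspan : Submodule.span ℤ (f '' (σ.flows : Set (E → ℤ))) = σ.flows.map f := by
    rw [← Submodule.map_span, Submodule.span_eq]
  have hle : Submodule.span ℤ (f '' (σ.flows : Set (E → ℤ))) ≤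
      Submodule.span ℤ (Set.range (EuclideanSpace.basisFun E ℝ).toBasis) := by
    rw [Submodule.span_le]
    rintro _ ⟨a, -, rfl⟩
    rw [SetLike.mem_coe, Module.Basis.mem_span_iff_repr_mem]
    exact fun e => ⟨a e, by simp [f]⟩
  have hdisc : DiscreteTopology (Submodule.span ℤ (f '' (σ.flows : Set (E → ℤ)))) :=
    DiscreteTopology.of_subset (s := (Submodule.span ℤ
      (Set.range (EuclideanSpace.basisFun E ℝ).toBasis) : Set (EuclideanSpace ℝ E)))
      (inferInstanceAs (DiscreteTopology (Submodule.span ℤ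
        (Set.range (EuclideanSpace.basisFun E ℝ).toBasis)))) hle
  have hWspan : W = Submodule.span ℝ (f '' (σ.flows : Set (E → ℤ))) := by
    apply le_antisymm
    · intro b hb
      obtain ⟨h1, h2⟩ := (hW b).1 hb
      exact mem_span_of_mem_realFlows (T := σ.edges) h1 fun e he => h2 e (not_not.1 he)
    · rw [Submodule.span_le]
      rintro _ ⟨a, ha, rfl⟩
      refine (hW _).2 ⟨toEuclidean_mem_realFlows ha.1, fun e he => ?_⟩
      have := ha.2 e (not_not.2 he)
      change ((a e : ℤ) : ℝ) = 0
      rw [this, Int.cast_zero]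
  have h := Real.finrank_eq_int_finrank_of_discrete hdisc
  rw [Set.finrank, Set.finrank, hspan, ← hWspan] at h
  rw [h, StrongOrientation.genus]
  exact (Submodule.equivMapOfInjective f hf σ.flows).finrank_eq

end Flows

/-! ### The Voronoi cell as a zonotope, and its faces -/

theorem euclidean_inner_eq_sum [Fintype E] (x y : EuclideanSpace ℝ E) :
    inner ℝ x y = ∑ e, x e * y e := by
  simp only [PiLp.inner_apply, RCLike.inner_apply, conj_trivial, mul_comm]

/-- Coefficients are `0` or `±1`. This turns the Voronoi inequality of a circuit into an `ℓ¹` bound.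
-/
theorem OrientedCircuit.inner_vec_self [Fintype E] (C : OrientedCircuit G) :
    inner ℝ (toEuclidean C.vec) (toEuclidean C.vec) = ∑ e, |toEuclidean C.vec e| := by
  rw [euclidean_inner_eq_sum]
  refine Finset.sum_congr rfl fun e _ => ?_
  rw [OrientedCircuit.toEuclidean_vec_apply]
  rcases (C.dir e).trichotomy with h | h | h <;> simp [h]

/-- Half the sign vector of `a`. -/
noncomputable def halfSign (a : EuclideanSpace ℝ E) : EuclideanSpace ℝ E :=
  WithLp.toLp 2 fun e => (SignType.sign (a e) : ℝ) / 2

theorem halfSign_apply (a : EuclideanSpace ℝ E) (e : E) :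
    halfSign a e = (SignType.sign (a e) : ℝ) / 2 := rfl

theorem abs_signType_cast_div_two_le (s : SignType) : |(s : ℝ) / 2| ≤ 1 / 2 := by
  rcases s.trichotomy with h | h | h <;> norm_num [h, abs_div]

theorem halfSign_mul (a : EuclideanSpace ℝ E) (e : E) : halfSign a e * a e = |a e| / 2 := by
  rw [halfSign_apply, div_mul_eq_mul_div, sign_mul_self]

theorem inner_starProjection_realFlows [DecidableEq V] [Fintype E] (x : EuclideanSpace ℝ E)
    {a : EuclideanSpace ℝ E} (ha : a ∈ G.realFlows) :
    inner ℝ (G.realFlows.starProjection x) a = inner ℝ x a := by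
  rw [Submodule.inner_starProjection_left_eq_right, Submodule.starProjection_eq_self_iff.2 ha]

/-- The points of the Voronoi cell at which the functional given by `a` is maximal. -/
def tightSet [DecidableEq V] [Fintype E] (G : OrientedMultigraph V E)
    (a : EuclideanSpace ℝ E) : Set (EuclideanSpace ℝ E) :=
  {x | x ∈ G.voronoiCell ∧ inner ℝ x a = (∑ e, |a e|) / 2}

theorem OrientedCircuit.facetSet_eq_tightSet [DecidableEq V] [Fintype E]
    (C : OrientedCircuit G) :
    C.facetSet = G.tightSet (toEuclidean C.vec) := by
  ext x
  rw [facetSet, tightSet, C.inner_vec_self]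

section Voronoi

variable [Fintype V] [DecidableEq V] [Fintype E]

/-- The Voronoi cell of the lattice of flows is a zonotope: its support function is half the
`ℓ¹`-norm. -/
theorem mem_voronoiCell_iff {x : EuclideanSpace ℝ E} :
    x ∈ G.voronoiCell ↔
      x ∈ G.realFlows ∧ ∀ a ∈ G.realFlows, inner ℝ x a ≤ (∑ e, |a e|) / 2 := by
  rw [← flowSpace_eq_realFlows]
  refine and_congr_right fun _ => ⟨fun h a ha => ?_, fun h a ha => ?_⟩
  -- The Voronoi inequalities of circuits add up along a cancellation-free decomposition.
  · rw [flowSpace_eq_realFlows] at ha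
    refine realFlows_induction (P := fun a => inner ℝ x a ≤ (∑ e, |a e|) / 2) (by simp)
      (fun a b C c hc _ hab habs ih => ?_) ha
    have hC := (dist_zero_le_iff _ _).1 (h _ C.vec_mem)
    rw [C.inner_vec_self] at hC
    simp only [habs, Finset.sum_add_distrib, ← Finset.mul_sum]
    rw [hab, inner_add_right, real_inner_smul_right]
    have := mul_le_mul_of_nonneg_left hC hc.le
    linarith
  -- Conversely, `|n| ≤ n²` for integers bounds the `ℓ¹`-norm by `(a, a)`.
  · have ha' : toEuclidean a ∈ G.flowSpace := Submodule.subset_span ⟨a, ha, rfl⟩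
    rw [dist_zero_le_iff]
    refine (h _ ha').trans (div_le_div_of_nonneg_right ?_ zero_le_two)
    rw [euclidean_inner_eq_sum]
    refine Finset.sum_le_sum fun e _ => ?_
    rw [toEuclidean_apply, ← abs_mul_abs_self]
    have : |a e| ≤ |a e| * |a e| := by
      rcases eq_or_ne (a e) 0 with h | h
      · simp [h]
      · exact le_mul_of_one_le_left (abs_nonneg _) (Int.one_le_abs h)
    have h := Int.cast_le (R := ℝ).2 this
    rwa [Int.cast_mul, Int.cast_abs] at h

theorem starProjection_mem_voronoiCell {t : EuclideanSpace ℝ E} (ht : ∀ e, |t e| ≤ 1 / 2) :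
    G.realFlows.starProjection t ∈ G.voronoiCell := by
  refine mem_voronoiCell_iff.2 ⟨Submodule.starProjection_apply_mem _ _, fun a ha => ?_⟩
  rw [inner_starProjection_realFlows _ ha, euclidean_inner_eq_sum, Finset.sum_div]
  refine Finset.sum_le_sum fun e _ => ?_
  calc t e * a e ≤ |t e * a e| := le_abs_self _
    _ = |t e| * |a e| := abs_mul _ _
    _ ≤ 1 / 2 * |a e| := mul_le_mul_of_nonneg_right (ht e) (abs_nonneg _)
    _ = |a e| / 2 := by ring

/-- Supplies test points of a face: `t` is pinned to half the sign of `a` on the support of `a` and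
is free in `[-1/2, 1/2]` elsewhere. -/
theorem starProjection_mem_tightSet {a t : EuclideanSpace ℝ E} (ha : a ∈ G.realFlows)
    (ht : ∀ e, |t e| ≤ 1 / 2) (hta : ∀ e, t e * a e = |a e| / 2) :
    G.realFlows.starProjection t ∈ G.tightSet a := by
  refine ⟨starProjection_mem_voronoiCell ht, ?_⟩
  rw [inner_starProjection_realFlows _ ha, euclidean_inner_eq_sum, Finset.sum_div]
  exact Finset.sum_congr rfl fun e _ => hta e

theorem tightSet_nonempty {a : EuclideanSpace ℝ E} (ha : a ∈ G.realFlows) :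
    (G.tightSet a).Nonempty :=
  ⟨_, starProjection_mem_tightSet ha (fun _ => abs_signType_cast_div_two_le _) (halfSign_mul a)⟩

theorem tightSet_eq {a : EuclideanSpace ℝ E} (ha : a ∈ G.realFlows) :
    G.tightSet a = {x ∈ G.voronoiCell | ∀ y ∈ G.voronoiCell, inner ℝ y a ≤ inner ℝ x a} := by
  ext x
  refine and_congr_right fun hx => ⟨fun h y hy => ?_, fun h => ?_⟩
  · rw [h]
    exact (mem_voronoiCell_iff.1 hy).2 a ha
  · obtain ⟨y, hy, hya⟩ := tightSet_nonempty ha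
    exact le_antisymm ((mem_voronoiCell_iff.1 hx).2 a ha) (hya ▸ h y hy)

theorem isExposed_tightSet {a : EuclideanSpace ℝ E} (ha : a ∈ G.realFlows) :
    IsExposed ℝ G.voronoiCell (G.tightSet a) := by
  refine fun _ => ⟨innerSL ℝ a, ?_⟩
  rw [tightSet_eq ha]
  simp only [innerSL_apply_apply, real_inner_comm]

/-- On the cell a functional is seen only through the projection of its Riesz vector to the flow
space. -/
theorem exists_eq_tightSet (F : VoronoiFace G) :
    ∃ a ∈ G.realFlows, F.1 = G.tightSet a := by
  obtain ⟨l, hl⟩ := F.2.2 F.2.1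
  set r := (InnerProductSpace.toDual ℝ (EuclideanSpace ℝ E)).symm l with hr
  have hmem := Submodule.starProjection_apply_mem G.realFlows r
  refine ⟨_, hmem, ?_⟩
  have h : ∀ y ∈ G.voronoiCell, l y = inner ℝ y (G.realFlows.starProjection r) := by
    intro y hy
    rw [real_inner_comm, inner_starProjection_realFlows _ (mem_voronoiCell_iff.1 hy).1, hr,
      InnerProductSpace.toDual_symm_apply]
  rw [hl, tightSet_eq hmem]
  ext x
  refine and_congr_right fun hx => forall₂_congr fun y hy => ?_
  rw [h x hx, h y hy]

/-- On the face defined by `a`, the flows supported in the support of `a` are constant. -/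
theorem inner_eq_of_mem_tightSet {a b x : EuclideanSpace ℝ E} (ha : a ∈ G.realFlows)
    (hb : b ∈ G.realFlows) (hab : ∀ e, a e = 0 → b e = 0) (hx : x ∈ G.tightSet a) :
    inner ℝ x b = (∑ e, (SignType.sign (a e) : ℝ) * b e) / 2 := by
  have key : ∀ b ∈ G.realFlows, (∀ e, a e = 0 → b e = 0) →
      inner ℝ x b ≤ (∑ e, (SignType.sign (a e) : ℝ) * b e) / 2 := by
    intro b hb hab
    -- This `K` is large enough that adding `b` to `K • a` reverses no sign, so the `ℓ¹`-norm is
    -- linear there; tightness at `a` then cancels the `K` terms.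
    set K := ∑ e, |b e| / |a e| with hK
    have hle : ∀ e, |b e| ≤ K * |a e| := by
      intro e
      by_cases h : a e = 0
      · simp [h, hab e h]
      · rw [← div_le_iff₀ (abs_pos.2 h)]
        exact Finset.single_le_sum (f := fun e => |b e| / |a e|)
          (fun e _ => div_nonneg (abs_nonneg _) (abs_nonneg _)) (Finset.mem_univ e)
    have habs : ∀ e, |K * a e + b e| = K * |a e| + (SignType.sign (a e) : ℝ) * b e := by
      intro e
      have := abs_le.1 (hle e)
      rcases lt_trichotomy (a e) 0 with h | h | h
      · rw [abs_of_neg h] at this ⊢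
        rw [sign_neg h, abs_of_nonpos (by linarith)]
        simp only [SignType.coe_neg_one]
        ring
      · simp [h, hab e h]
      · rw [abs_of_pos h] at this ⊢
        rw [sign_pos h, abs_of_nonneg (by linarith)]
        simp only [SignType.coe_one]
        ring
    have h := (mem_voronoiCell_iff.1 hx.1).2 (K • a + b)
      (Submodule.add_mem _ (Submodule.smul_mem _ _ ha) hb)
    simp only [PiLp.add_apply, PiLp.smul_apply, smul_eq_mul, habs, Finset.sum_add_distrib,
      ← Finset.mul_sum] at h
    rw [inner_add_right, real_inner_smul_right, hx.2] at h
    linarith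
  refine le_antisymm (key b hb hab) ?_
  have h := key (-b) (Submodule.neg_mem _ hb) fun e he => by simp [hab e he]
  simp only [inner_neg_right, PiLp.neg_apply, mul_neg, Finset.sum_neg_distrib] at h
  linarith

theorem tightSet_subset_iff {a b : EuclideanSpace ℝ E} (ha : a ∈ G.realFlows)
    (hb : b ∈ G.realFlows) : G.tightSet a ⊆ G.tightSet b ↔
      ∀ e, SignType.sign (b e) ≠ 0 → SignType.sign (a e) = SignType.sign (b e) := by
  constructor
  · intro hsub
    -- Off the support of `a` the test point takes the sign opposite to `b`. It lies in the face of
    -- `a`, hence must be tight for `b` at every edge.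
    let s : E → SignType := fun e => if a e = 0 then -SignType.sign (b e) else SignType.sign (a e)
    let t : EuclideanSpace ℝ E := WithLp.toLp 2 fun e => (s e : ℝ) / 2
    have ht : ∀ e, |t e| ≤ 1 / 2 := fun e => abs_signType_cast_div_two_le _
    have hmem : G.realFlows.starProjection t ∈ G.tightSet a := by
      refine starProjection_mem_tightSet ha ht fun e => ?_
      by_cases h : a e = 0
      · simp [h]
      · change (s e : ℝ) / 2 * a e = _
        simp only [s, h, if_false]
        exact halfSign_mul a e
    have h := (hsub hmem).2
    rw [inner_starProjection_realFlows _ hb, euclidean_inner_eq_sum, Finset.sum_div] at h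
    have hle : ∀ e ∈ Finset.univ, t e * b e ≤ |b e| / 2 := fun e _ =>
      calc t e * b e ≤ |t e * b e| := le_abs_self _
        _ = |t e| * |b e| := abs_mul _ _
        _ ≤ 1 / 2 * |b e| := mul_le_mul_of_nonneg_right (ht e) (abs_nonneg _)
        _ = |b e| / 2 := by ring
    intro e he
    have heq := (Finset.sum_eq_sum_iff_of_le hle).1 h e (Finset.mem_univ e)
    have hbe : 0 < |b e| := abs_pos.2 (sign_ne_zero.1 he)
    change (s e : ℝ) / 2 * b e = _ at heq
    have hs : s e = SignType.sign (b e) := by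
      have h2 : (s e : ℝ) * b e = |b e| := by linarith
      have h3 := congrArg SignType.sign h2
      rw [sign_mul, sign_signType_cast, sign_pos hbe] at h3
      generalize SignType.sign (b e) = u at h3 ⊢
      generalize s e = w at h3 ⊢
      revert u w
      decide
    simp only [s] at hs
    split_ifs at hs with h0
    · exact absurd (SignType.neg_eq_self_iff.1 hs) he
    · exact hs
  · intro h x hx
    refine ⟨hx.1, ?_⟩
    rw [inner_eq_of_mem_tightSet ha hb (fun e he => ?_) hx]
    · congr 1
      refine Finset.sum_congr rfl fun e _ => ?_
      by_cases hbe : SignType.sign (b e) = 0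
      · simp [sign_eq_zero_iff.1 hbe]
      · rw [h e hbe, sign_mul_self]
    · by_contra hbe
      exact sign_ne_zero.2 hbe (by rw [← h e (sign_ne_zero.2 hbe), he, sign_zero])

theorem tightSet_congr {a b : EuclideanSpace ℝ E} (ha : a ∈ G.realFlows) (hb : b ∈ G.realFlows)
    (h : ∀ e, SignType.sign (a e) = SignType.sign (b e)) : G.tightSet a = G.tightSet b :=
  ((tightSet_subset_iff ha hb).2 fun e _ => h e).antisymm
    ((tightSet_subset_iff hb ha).2 fun e _ => (h e).symm)

theorem mem_orthogonal_vectorSpan_tightSet_iff {a b : EuclideanSpace ℝ E} (ha : a ∈ G.realFlows) :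
    b ∈ (vectorSpan ℝ (G.tightSet a))ᗮ ⊓ G.realFlows ↔
      b ∈ G.realFlows ∧ ∀ e, a e = 0 → b e = 0 := by
  classical
  rw [Submodule.mem_inf, and_comm]
  refine and_congr_right fun hb => ⟨fun h e he => ?_, fun h => ?_⟩
  -- As `a e = 0`, the coordinate at `e` can move by `1/2` within the face; orthogonality of `b` to
  -- this displacement says `b e = 0`.
  · let t : EuclideanSpace ℝ E := halfSign a + EuclideanSpace.single e (1 / 2)
    have hmem : G.realFlows.starProjection t ∈ G.tightSet a := by
      refine starProjection_mem_tightSet ha (fun e' => ?_) fun e' => ?_ <;>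
        rcases eq_or_ne e' e with rfl | h'
      · simp [t, halfSign_apply, he, abs_of_pos]
      · simpa [t, h', halfSign_apply] using abs_signType_cast_div_two_le (SignType.sign (a e'))
      · simp [he]
      · simpa [t, h'] using halfSign_mul a e'
    have hmem' := starProjection_mem_tightSet ha (t := halfSign a)
      (fun _ => abs_signType_cast_div_two_le _) (halfSign_mul a)
    have hz := Submodule.mem_orthogonal _ _ |>.1 h _ (vsub_mem_vectorSpan ℝ hmem hmem')
    rw [vsub_eq_sub, inner_sub_left, inner_starProjection_realFlows _ hb,
      inner_starProjection_realFlows _ hb, inner_add_left, add_sub_cancel_left,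
      EuclideanSpace.inner_single_left] at hz
    simpa using hz
  · rw [Submodule.mem_orthogonal]
    intro u hu
    refine Submodule.span_induction (p := fun u _ => inner ℝ u b = 0) ?_ (inner_zero_left _)
      (fun x y _ _ hx hy => by rw [inner_add_left, hx, hy, add_zero])
      (fun c x _ hx => by rw [real_inner_smul_left, hx, mul_zero]) hu
    rintro _ ⟨x, hx, y, hy, rfl⟩
    change inner ℝ (x -ᵥ y) b = 0
    rw [vsub_eq_sub, inner_sub_left, inner_eq_of_mem_tightSet ha hb h hx,
      inner_eq_of_mem_tightSet ha hb h hy, sub_self]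

theorem faceCodim_eq_genus {F : VoronoiFace G} {σ : StrongOrientation G} {a : EuclideanSpace ℝ E}
    (ha : a ∈ G.realFlows) (hF : F.1 = G.tightSet a) (hσ : ∀ e, SignType.sign (a e) = σ.dir e) :
    faceCodim F = σ.genus := by
  have hle : vectorSpan ℝ (G.tightSet a) ≤ G.realFlows := by
    refine Submodule.span_le.2 ?_
    rintro _ ⟨x, hx, y, hy, rfl⟩
    exact Submodule.sub_mem _ (mem_voronoiCell_iff.1 hx.1).1 (mem_voronoiCell_iff.1 hy.1).1
  rw [σ.genus_eq fun b => (mem_orthogonal_vectorSpan_tightSet_iff ha).trans (and_congr_right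
    fun _ => forall_congr' fun e => by rw [← hσ, sign_eq_zero_iff]), faceCodim, hF,
    flowSpace_eq_realFlows]
  have := Submodule.finrank_add_inf_finrank_orthogonal hle
  omega

/-! ### Amini's isomorphism and its uniqueness -/

/-- The face of the Voronoi cell defined by a strongly connected orientation of a subgraph. -/
noncomputable def StrongOrientation.face (σ : StrongOrientation G) : VoronoiFace G :=
  ⟨G.tightSet σ.exists_flow.choose, tightSet_nonempty σ.exists_flow.choose_spec.1,
    isExposed_tightSet σ.exists_flow.choose_spec.1⟩

/-- The face does not depend on the flow chosen to define it. -/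
theorem StrongOrientation.face_eq (σ : StrongOrientation G) {a : EuclideanSpace ℝ E}
    (ha : a ∈ G.realFlows) (h : ∀ e, SignType.sign (a e) = σ.dir e) :
    σ.face.1 = G.tightSet a :=
  tightSet_congr σ.exists_flow.choose_spec.1 ha fun e =>
    (σ.exists_flow.choose_spec.2 e).trans (h e).symm

theorem StrongOrientation.face_le_face_iff {σ τ : StrongOrientation G} :
    σ.face ≤ τ.face ↔ σ ≤ τ := by
  refine (tightSet_subset_iff σ.exists_flow.choose_spec.1 τ.exists_flow.choose_spec.1).trans ?_
  simp only [σ.exists_flow.choose_spec.2, τ.exists_flow.choose_spec.2]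
  rfl

theorem StrongOrientation.face_surjective :
    Function.Surjective (StrongOrientation.face : StrongOrientation G → VoronoiFace G) := by
  intro F
  obtain ⟨a, ha, hF⟩ := exists_eq_tightSet F
  let σ : StrongOrientation G := ⟨_, isStronglyConnected_sign ha⟩
  exact ⟨σ, Subtype.ext ((σ.face_eq ha fun _ => rfl).trans hF.symm)⟩

/-- Amini's isomorphism. -/
noncomputable def aminiIso (G : OrientedMultigraph V E) : VoronoiFace G ≃o StrongOrientation G :=
  (RelIso.ofSurjective (OrderEmbedding.ofMapLEIff StrongOrientation.face
    fun _ _ => StrongOrientation.face_le_face_iff) StrongOrientation.face_surjective).symm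

theorem aminiIso_face (σ : StrongOrientation G) : aminiIso G σ.face = σ :=
  (aminiIso G).apply_symm_apply σ

/-- A circuit, as a strongly connected oriented subgraph. -/
def OrientedCircuit.toStrong (C : OrientedCircuit G) : StrongOrientation G :=
  ⟨C.dir, by
    have h := isStronglyConnected_sign (toEuclidean_mem_realFlows C.vec_mem)
    simpa only [OrientedCircuit.toEuclidean_vec_apply, sign_signType_cast] using h⟩

theorem OrientedCircuit.face_toStrong (C : OrientedCircuit G) : C.toStrong.face = C.facet :=
  Subtype.ext ((C.toStrong.face_eq (toEuclidean_mem_realFlows C.vec_mem) fun e => by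
    rw [OrientedCircuit.toEuclidean_vec_apply, sign_signType_cast]; rfl).trans
      C.facetSet_eq_tightSet.symm)

theorem isAminiIso_aminiIso (G : OrientedMultigraph V E) : IsAminiIso (aminiIso G) := by
  refine ⟨fun F => ?_, fun C => ?_⟩
  · obtain ⟨σ, rfl⟩ := StrongOrientation.face_surjective F
    rw [aminiIso_face]
    exact faceCodim_eq_genus σ.exists_flow.choose_spec.1 rfl σ.exists_flow.choose_spec.2
  · rw [← C.face_toStrong, aminiIso_face]
    rfl

theorem IsAminiIso.apply_facet {Φ : VoronoiFace G ≃o StrongOrientation G} (hΦ : IsAminiIso Φ)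
    (C : OrientedCircuit G) : Φ C.facet = C.toStrong :=
  StrongOrientation.ext (hΦ.2 C)

theorem IsAminiIso.le_facet_iff {Φ : VoronoiFace G ≃o StrongOrientation G} (hΦ : IsAminiIso Φ)
    (F : VoronoiFace G) (C : OrientedCircuit G) :
    F ≤ C.facet ↔ ∀ e, C.dir e ≠ 0 → (Φ F).dir e = C.dir e := by
  rw [← Φ.le_iff_le, hΦ.apply_facet]
  rfl

theorem IsAminiIso.unique {Φ Ψ : VoronoiFace G ≃o StrongOrientation G} (hΦ : IsAminiIso Φ)
    (hΨ : IsAminiIso Ψ) : Φ = Ψ := by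
  have key : ∀ {Φ Ψ : VoronoiFace G ≃o StrongOrientation G}, IsAminiIso Φ → IsAminiIso Ψ →
      ∀ F, Ψ F ≤ Φ F := by
    intro Φ Ψ hΦ hΨ F e he
    -- A circuit of `Φ F` through `e` has a facet containing `F`, so it is also a circuit of `Ψ F`.
    obtain ⟨C, hC, hC'⟩ := exists_circuit (Φ F).strong he
    rw [hC' e hC]
    exact (hΨ.le_facet_iff F C).1 ((hΦ.le_facet_iff F C).2 hC') e hC
  refine RelIso.ext fun F => ?_
  exact le_antisymm (key hΨ hΦ F) (key hΦ hΨ F)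

/-- The union of compatible circuits is strongly connected. -/
theorem exists_strongOrientation_of_compatible {ι : Type*} [Fintype ι] (C : ι → OrientedCircuit G)
    (h : ∀ i j, (C i).Compatible (C j)) : ∃ σ : StrongOrientation G,
      (∀ i e, (C i).dir e ≠ 0 → σ.dir e = (C i).dir e) ∧
      ∀ e, σ.dir e ≠ 0 → ∃ i, (C i).dir e ≠ 0 := by
  classical
  let τ : E → SignType := fun e =>
    if h : ∃ i, (C i).dir e ≠ 0 then (C h.choose).dir e else 0
  have h₁ : ∀ i e, (C i).dir e ≠ 0 → τ e = (C i).dir e := by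
    intro i e he
    have hex : ∃ i, (C i).dir e ≠ 0 := ⟨i, he⟩
    simp only [τ, hex, dif_pos]
    exact h _ _ e hex.choose_spec he
  have h₂ : ∀ e, τ e ≠ 0 → ∃ i, (C i).dir e ≠ 0 := by
    intro e he
    by_contra hex
    exact he (dif_neg hex)
  -- Strong connectivity is obtained from a flow with signs `τ`, with no walks to construct.
  obtain ⟨a, ha, hτ⟩ := exists_flow_of_cover C h₁ h₂
  have hs := isStronglyConnected_sign ha
  simp only [hτ] at hs
  exact ⟨⟨τ, hs⟩, h₁, h₂⟩

end Voronoi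

end OrientedMultigraph

theorem mainTheorem5 {V E : Type*} [Fintype V] [DecidableEq V] [Fintype E]
    (G : OrientedMultigraph V E) :
    (∃! Φ : G.VoronoiFace ≃o G.StrongOrientation, OrientedMultigraph.IsAminiIso Φ) ∧
    ∀ (s : ℕ) (C : Fin s → G.OrientedCircuit) (F : G.VoronoiFace),
      (F : Set (EuclideanSpace ℝ E)) = ⋂ i, ((C i).facet : Set (EuclideanSpace ℝ E)) →
      (∀ i j, (C i).Compatible (C j)) ∧
      ∀ Φ : G.VoronoiFace ≃o G.StrongOrientation, OrientedMultigraph.IsAminiIso Φ →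
        (Φ F).edges = ⋃ i, (C i).edges ∧
        ∀ i, ∀ e ∈ (C i).edges, (Φ F).dir e = (C i).dir e := by
  refine ⟨⟨_, OrientedMultigraph.isAminiIso_aminiIso G, fun Ψ hΨ =>
    hΨ.unique (OrientedMultigraph.isAminiIso_aminiIso G)⟩, fun s C F hF => ?_⟩
  have hdir : ∀ Φ : G.VoronoiFace ≃o G.StrongOrientation, OrientedMultigraph.IsAminiIso Φ →
      ∀ i, ∀ e, (C i).dir e ≠ 0 → (Φ F).dir e = (C i).dir e := fun Φ hΦ i =>
    (hΦ.le_facet_iff F (C i)).1 (hF.subset.trans (Set.iInter_subset _ i))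
  have hcomp : ∀ i j, (C i).Compatible (C j) := fun i j e hi hj =>
    (hdir _ (OrientedMultigraph.isAminiIso_aminiIso G) i e hi).symm.trans
      (hdir _ (OrientedMultigraph.isAminiIso_aminiIso G) j e hj)
  refine ⟨hcomp, fun Φ hΦ => ⟨Set.Subset.antisymm (fun e he => ?_)
    (Set.iUnion_subset fun i e he => ?_), hdir Φ hΦ⟩⟩
  -- The face of the union `σ` of the circuits lies in each facet, hence in `F`; reversing the
  -- order, `Φ F` has no edge outside `σ`.
  · obtain ⟨σ, h₁, h₂⟩ := OrientedMultigraph.exists_strongOrientation_of_compatible C hcomp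
    have hle : Φ.symm σ ≤ F := by
      change (Φ.symm σ).1 ⊆ F.1
      rw [hF]
      refine Set.subset_iInter fun i => (hΦ.le_facet_iff (Φ.symm σ) (C i)).2 ?_
      rw [Φ.apply_symm_apply]
      exact h₁ i
    have hσ : σ ≤ Φ F := by rwa [← Φ.symm_apply_le]
    have he' : σ.dir e ≠ 0 := by
      rw [hσ e he]
      exact he
    exact Set.mem_iUnion.2 (h₂ e he')
  · change (Φ F).dir e ≠ 0
    rw [hdir Φ hΦ i e he]
    exact he
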